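/- Let $\mathbb{F}$ be a division ring, $\sigma:\mathbb{F}\to\mathbb{F}^{n\times n}$ a ring morphism and $\delta:\mathbb{F}\to\mathbb{F}^n$ a $\sigma$-derivation (additive, with $\delta(ab)=\sigma(a)\delta(b)+\delta(a)b$). Let $R=\mathbb{F}[\mathbf{x};\sigma,\delta]$ be the free multivariate skew polynomial ring: the left $\mathbb{F}$-vector space whose basis is the free monoid $\mathcal{M}$ on $x_1,\dots,x_n$, with product given by appending monomials and $x_i a=\sum_j\sigma_{i,j}(a)x_j+\delta_i(a)$. For $\mathbf{a}\in\mathbb{F}^n$ and $F\in R$, $F(\mathbf{a})\in\mathbb{F}$ is the unique element with $F-F(\mathbf{a})$ in the left ideal $(x_1-a_1,\dots,x_n-a_n)$. For $\Omega\subseteq\mathbb{F}^n$ put $I(\Omega)=\{F\in R: F(\mathbf{a})=0\ \forall\mathbf{a}\in\Omega\}$ (a left ideal) and $\overline{\Omega}=\{\mathbf{a}: F(\mathbf{a})=0\ \forall F\in I(\Omega)\}$. The set $\Omega$ is P-closed if $\overline{\Omega}=\Omega$; it is then finitely generated if $\Omega=\overline{\mathcal{G}}$ for a finite $\mathcal{G}\subseteq\Omega$;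 a P-basis of $\Omega$ is a set $\mathcal{B}\subseteq\Omega$ with $\overline{\mathcal{B}}=\Omega$ and $\mathbf{b}\notin\overline{\mathcal{B}\setminus\{\mathbf{b}\}}$ for all $\mathbf{b}\in\mathcal{B}$; and $\mathrm{Rk}(\Omega)$ is the number of elements of a P-basis. For $\mathbf{a}\in\mathbb{F}^n$ let $\mathcal{D}_{\mathbf{a}}(\beta)=\sigma(\beta)\mathbf{a}+\delta(\beta)\in\mathbb{F}^n$, let $\mathcal{D}_{\mathbf{a}}^{\mathfrak{m}}:\mathbb{F}\to\mathbb{F}$ be given by $\mathcal{D}_{\mathbf{a}}^1=\mathrm{Id}$ and $\mathcal{D}_{\mathbf{a}}^{x_i\mathfrak{m}}=(\mathcal{D}_{\mathbf{a}})_i\circ\mathcal{D}_{\mathbf{a}}^{\mathfrak{m}}$, let $\mathbb{F}[\mathcal{D}_{\mathbf{a}}]$ be the left $\mathbb{F}$-span of the $\mathcal{D}_{\mathbf{a}}^{\mathfrak{m}}$, $\mathfrak{m}\in\mathcal{M}$, a ring under composition, and for $F=\sum F_{\mathfrak{m}}\mathfrak{m}\in R$ let $F^{\mathcal{D}_{\mathbf{a}}}=\sum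 F_{\mathfrak{m}}\mathcal{D}_{\mathbf{a}}^{\mathfrak{m}}$. For $\beta\neq0$ put $\mathbf{a}^\beta=\mathcal{D}_{\mathbf{a}}(\beta)\beta^{-1}$; let $\mathcal{C}(\mathbf{a})=\{\mathbf{a}^\beta:\beta\in\mathbb{F}^*\}$ be the conjugacy class of $\mathbf{a}$ and $K_{\mathbf{a}}=\{\beta\in\mathbb{F}:\mathcal{D}_{\mathbf{a}}(\beta)=\mathbf{a}\beta\}$ its centralizer, a division subring of $\mathbb{F}$. **Theorem.** Let $\Omega\subseteq\mathbb{F}^n$ be a finitely generated P-closed set, let $\mathbf{a}_1,\dots,\mathbf{a}_\ell\in\mathbb{F}^n$ be pairwise non-conjugate, and let $\Omega_i=\Omega\cap\mathcal{C}(\mathbf{a}_i)\neq\varnothing$, where $\Omega=\Omega_1\cup\dots\cup\Omega_\ell$. Let $\Omega_i^{\mathcal{D}}\subseteq\mathbb{F}$ be the right $K_{\mathbf{a}_i}$-subspace spanned by the $\beta\ne0$ with $\mathbf{a}_i^\beta\in\Omega_i$, and let $I(\Omega_i^{\mathcal{D}})$ be the left ideal of those elements of $\mathbb{F}[\mathcal{D}_{\mathbf{a}_i}]$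 that vanish on $\Omega_i^{\mathcal{D}}$. Then: 1. Each $\Omega_i$ is P-closed and finitely generated, $\Omega_i^{\mathcal{D}}$ is finite-dimensional over $K_{\mathbf{a}_i}$, and $\Omega_i=\{\mathbf{a}_i^\beta:\beta\in\Omega_i^{\mathcal{D}}\setminus\{0\}\}$. 2. The maps $$R/I(\Omega)\to\bigoplus_{i=1}^\ell R/I(\Omega_i)\to\bigoplus_{i=1}^\ell\mathbb{F}[\mathcal{D}_{\mathbf{a}_i}]/I(\Omega_i^{\mathcal{D}}),$$ $$F+I(\Omega)\mapsto(F+I(\Omega_i))_i,\qquad (F_i+I(\Omega_i))_i\mapsto(F_i^{\mathcal{D}_{\mathbf{a}_i}}+I(\Omega_i^{\mathcal{D}}))_i,$$ are well-defined isomorphisms of left $\mathbb{F}$-vector spaces and of left $R$-modules, where $F\in R$ acts on the $i$-th summand on the right as $F^{\mathcal{D}_{\mathbf{a}_i}}$. Moreover, $I(\Omega)$ is two-sided if and only if all $I(\Omega_i)$ are, and if and only if all $I(\Omega_i^{\mathcal{D}})$ are; in that case the quotients are rings and both maps are left $\mathbb{F}$-algebra isomorphisms (coordinatewise products on the direct sums),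 that is, left $\mathbb{F}$-linear ring isomorphisms. 3. $\Omega$ and every $\Omega_i$ have P-bases, all P-bases of each of them are finite of the same size, and for every $i$ $$\dim^L_{\mathbb{F}}\big(\mathbb{F}[\mathcal{D}_{\mathbf{a}_i}]/I(\Omega_i^{\mathcal{D}})\big)=\dim^R_{K_{\mathbf{a}_i}}(\Omega_i^{\mathcal{D}})=\mathrm{Rk}(\Omega_i).$$ In particular $$\sum_{i=1}^\ell\dim^L_{\mathbb{F}}\big(\mathbb{F}[\mathcal{D}_{\mathbf{a}_i}]/I(\Omega_i^{\mathcal{D}})\big)=\sum_{i=1}^\ell\dim^R_{K_{\mathbf{a}_i}}(\Omega_i^{\mathcal{D}})=\sum_{i=1}^\ell\mathrm{Rk}(\Omega_i)=\dim^L_{\mathbb{F}}\big(R/I(\Omega)\big)=\mathrm{Rk}(\Omega).$$ -/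

import Mathlib

universe u

namespace SkewPolys

noncomputable section

/-- A `σ`-derivation `δ : F → Fⁿ` for a ring morphism `σ : F → Fⁿˣⁿ`: an additive map with
`δ(ab) = σ(a) δ(b) + δ(a) b` (the elements of `Fⁿ` are column vectors). -/
structure SkewDerivation {F : Type u} [DivisionRing F] {n : ℕ}
    (σ : F →+* Matrix (Fin n) (Fin n) F) extends F →+ (Fin n → F) where
  leibniz' : ∀ a b : F,
    toFun (a * b) = Matrix.mulVec (σ a) (toFun b) + fun i => toFun a i * b

instance {F : Type u} [DivisionRing F] {n : ℕ} (σ : F →+* Matrix (Fin n) (Fin n) F) :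
    CoeFun (SkewDerivation σ) (fun _ => F → Fin n → F) where
  coe δ := δ.toAddMonoidHom

section Derivation

variable {F : Type u} [DivisionRing F] {n : ℕ} {σ : F →+* Matrix (Fin n) (Fin n) F}

theorem SkewDerivation.map_add (δ : SkewDerivation σ) (a b : F) : δ (a + b) = δ a + δ b :=
  δ.toAddMonoidHom.map_add a b

theorem SkewDerivation.map_zero (δ : SkewDerivation σ) : δ 0 = 0 :=
  δ.toAddMonoidHom.map_zero

theorem SkewDerivation.map_mul (δ : SkewDerivation σ) (a b : F) (i : Fin n) :
    δ (a * b) i = ∑ j, σ a i j * δ b j + δ a i * b :=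
  congrFun (δ.leibniz' a b) i

theorem SkewDerivation.map_one (δ : SkewDerivation σ) : δ 1 = 0 := by
  funext i
  have h := δ.map_mul 1 1 i
  simp [Matrix.one_apply] at h
  simpa using h

theorem map_mul_apply (σ : F →+* Matrix (Fin n) (Fin n) F) (a b : F) (i j : Fin n) :
    σ (a * b) i j = ∑ k, σ a i k * σ b k j := by
  rw [map_mul, Matrix.mul_apply]

/-- The free multivariate skew polynomial ring `F[x; σ, δ]`: as a left `F`-vector space it has
as basis the free monoid of the words in the letters `x₁, …, xₙ`. -/
def SkewPoly (σ : F →+* Matrix (Fin n) (Fin n) F) (_δ : SkewDerivation σ) : Type u :=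
  FreeMonoid (Fin n) →₀ F

end Derivation

section Ring

variable {F : Type u} [DivisionRing F] {n : ℕ} {σ : F →+* Matrix (Fin n) (Fin n) F}
  {δ : SkewDerivation σ}

instance : AddCommGroup (SkewPoly σ δ) := inferInstanceAs (AddCommGroup (FreeMonoid (Fin n) →₀ F))

instance : Module F (SkewPoly σ δ) := inferInstanceAs (Module F (FreeMonoid (Fin n) →₀ F))

/-- The skew polynomial `c 𝔪` with one coefficient `c` at the monomial `𝔪`. -/
def term (δ : SkewDerivation σ) (m : FreeMonoid (Fin n)) (c : F) : SkewPoly σ δ :=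
  Finsupp.single m c

theorem term_add (m : FreeMonoid (Fin n)) (c d : F) :
    term δ m (c + d) = term δ m c + term δ m d := Finsupp.single_add m c d

theorem term_zero (m : FreeMonoid (Fin n)) : term δ m 0 = 0 := Finsupp.single_zero m

theorem smul_term (m : FreeMonoid (Fin n)) (c d : F) :
    c • term δ m d = term δ m (c * d) := Finsupp.smul_single c m d

theorem SkewPoly.induction {p : SkewPoly σ δ → Prop} (f : SkewPoly σ δ) (h0 : p 0)
    (hadd : ∀ f g, p f → p g → p (f + g)) (ht : ∀ m c, p (term δ m c)) : p f :=
  Finsupp.induction_linear f h0 hadd ht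

/-- Additive operators `Y₁, …, Yₙ` on a left vector space obeying the rule
`Yᵢ c = ∑ⱼ σᵢⱼ(c) Yⱼ + δᵢ(c)`. -/
def Obeys (δ : SkewDerivation σ) {W : Type u} [AddCommGroup W] [Module F W]
    (Y : Fin n → AddMonoid.End W) : Prop :=
  ∀ (i : Fin n) (c : F) (w : W), Y i (c • w) = ∑ j, σ c i j • Y j w + δ c i • w

/-- For additive operators `Y₁, …, Yₙ` on a left vector space, the left linear map
`∑ F_𝔪 𝔪 ↦ ∑ F_𝔪 𝔪(Y₁, …, Yₙ)` into operators. -/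
def act (δ : SkewDerivation σ) {W : Type u} [AddCommGroup W] [Module F W]
    (Y : Fin n → AddMonoid.End W) : SkewPoly σ δ →ₗ[F] AddMonoid.End W :=
  Finsupp.linearCombination F (fun m => FreeMonoid.lift Y m)

theorem act_term {W : Type u} [AddCommGroup W] [Module F W] (Y : Fin n → AddMonoid.End W)
    (m : FreeMonoid (Fin n)) (c : F) (w : W) :
    act δ Y (term δ m c) w = c • FreeMonoid.lift Y m w := by
  have : act δ Y (term δ m c) = c • (FreeMonoid.lift Y m : AddMonoid.End W) :=
    Finsupp.linearCombination_single F c m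
  rw [this]; rfl

theorem End_add_apply {W : Type u} [AddCommGroup W] (S T : AddMonoid.End W) (w : W) :
    (S + T) w = S w + T w := rfl

theorem End_mul_apply {W : Type u} [AddCommGroup W] (S T : AddMonoid.End W) (w : W) :
    (S * T) w = S (T w) := rfl

theorem End_sub_apply {W : Type u} [AddCommGroup W] (S T : AddMonoid.End W) (w : W) :
    (S - T) w = S w - T w := rfl

theorem End_sum_apply {W : Type u} [AddCommGroup W] (s : Finset (Fin n))
    (T : Fin n → AddMonoid.End W) (w : W) : (∑ i ∈ s, T i) w = ∑ i ∈ s, T i w :=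
  AddMonoidHom.finsetSum_apply T s w

/-- Left multiplication by the variable `xᵢ`, as dictated by `xᵢ c = ∑ⱼ σᵢⱼ(c) xⱼ + δᵢ(c)`:
it maps `c 𝔪` to `∑ⱼ σᵢⱼ(c) xⱼ𝔪 + δᵢ(c) 𝔪`. -/
def mulVar (δ : SkewDerivation σ) (i : Fin n) : AddMonoid.End (SkewPoly σ δ) :=
  Finsupp.liftAddHom (M := F) (N := SkewPoly σ δ) fun m : FreeMonoid (Fin n) =>
    { toFun := fun c => ∑ j, term δ (FreeMonoid.of j * m) (σ c i j) + term δ m (δ c i)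
      map_zero' := by simp [term_zero, SkewDerivation.map_zero]
      map_add' := fun c d => by
        simp only [map_add, Matrix.add_apply, term_add, Finset.sum_add_distrib,
          Pi.add_apply]
        abel }

theorem mulVar_term (i : Fin n) (m : FreeMonoid (Fin n)) (c : F) :
    mulVar δ i (term δ m c) =
      ∑ j, term δ (FreeMonoid.of j * m) (σ c i j) + term δ m (δ c i) :=
  Finsupp.liftAddHom_apply_single _ m c

theorem mulVar_one (i : Fin n) (m : FreeMonoid (Fin n)) :
    mulVar δ i (term δ m 1) = term δ (FreeMonoid.of i * m) 1 := by
  rw [mulVar_term, SkewDerivation.map_one, Pi.zero_apply, term_zero, add_zero, map_one,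
    Finset.sum_eq_single i]
  · simp
  · intro j _ hj
    rw [Matrix.one_apply_ne' hj, term_zero]
  · simp

theorem obeys_mulVar : Obeys δ (mulVar δ) := by
  intro i c f
  induction f using SkewPoly.induction with
  | h0 => simp
  | hadd f g hf hg =>
    simp only [smul_add, map_add, hf, hg, Finset.sum_add_distrib]
    abel
  | ht m d =>
    simp only [smul_term, mulVar_term, smul_add, Finset.smul_sum, Finset.sum_add_distrib]
    rw [Finset.sum_comm, SkewDerivation.map_mul, term_add, ← add_assoc]
    congr 1
    congr 1
    · refine Finset.sum_congr rfl fun j _ => ?_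
      rw [map_mul_apply]
      exact map_sum (Finsupp.singleAddHom (FreeMonoid.of j * m)) _ _
    · exact map_sum (Finsupp.singleAddHom m) _ _

theorem act_mulVar {W : Type u} [AddCommGroup W] [Module F W] {Y : Fin n → AddMonoid.End W}
    (hY : Obeys δ Y) (i : Fin n) (f : SkewPoly σ δ) (w : W) :
    act δ Y (mulVar δ i f) w = Y i (act δ Y f w) := by
  induction f using SkewPoly.induction with
  | h0 => simp
  | hadd f g hf hg =>
    rw [map_add, map_add, map_add, End_add_apply, End_add_apply, map_add, hf, hg]
  | ht m c =>
    rw [mulVar_term, map_add, map_sum, act_term, hY, End_add_apply, End_sum_apply, act_term]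
    congr 1
    refine Finset.sum_congr rfl fun j _ => ?_
    rw [act_term, map_mul, FreeMonoid.lift_eval_of]
    rfl

theorem act_word {W : Type u} [AddCommGroup W] [Module F W] {Y : Fin n → AddMonoid.End W}
    (hY : Obeys δ Y) (m : FreeMonoid (Fin n)) (f : SkewPoly σ δ) (w : W) :
    act δ Y (FreeMonoid.lift (mulVar δ) m f) w = FreeMonoid.lift Y m (act δ Y f w) := by
  induction m using FreeMonoid.inductionOn' with
  | one => simp
  | of_mul i m ih =>
    rw [map_mul, map_mul, FreeMonoid.lift_eval_of, FreeMonoid.lift_eval_of,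
      End_mul_apply, End_mul_apply, act_mulVar hY, ih]

theorem act_act {W : Type u} [AddCommGroup W] [Module F W] {Y : Fin n → AddMonoid.End W}
    (hY : Obeys δ Y) (f g : SkewPoly σ δ) (w : W) :
    act δ Y (act δ (mulVar δ) f g) w = act δ Y f (act δ Y g w) := by
  induction f using SkewPoly.induction with
  | h0 => simp
  | hadd f₁ f₂ h₁ h₂ =>
    rw [map_add, map_add, End_add_apply, End_add_apply, map_add, End_add_apply, h₁, h₂]
  | ht m c =>
    rw [act_term, act_term, map_smul, ← act_word hY]
    rfl

theorem word_one (m k : FreeMonoid (Fin n)) :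
    FreeMonoid.lift (mulVar δ) m (term δ k 1) = term δ (m * k) 1 := by
  induction m using FreeMonoid.inductionOn' with
  | one => simp
  | of_mul i m ih =>
    rw [map_mul, FreeMonoid.lift_eval_of, End_mul_apply, ih, mulVar_one, mul_assoc]

theorem act_one_right (f : SkewPoly σ δ) : act δ (mulVar δ) f (term δ 1 1) = f := by
  induction f using SkewPoly.induction with
  | h0 => simp
  | hadd f g hf hg =>
    rw [map_add, End_add_apply, hf, hg]
  | ht m c => rw [act_term, word_one, mul_one, smul_term, mul_one]

theorem act_one_left {W : Type u} [AddCommGroup W] [Module F W] (Y : Fin n → AddMonoid.End W)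
    (w : W) : act δ Y (term δ 1 1) w = w := by
  rw [act_term, one_smul, map_one]; rfl

/-- The product of skew polynomials: `(∑ F_𝔪 𝔪) G = ∑ F_𝔪 (𝔪 G)`, where a monomial multiplies
letter by letter through `mulVar`. -/
instance : Mul (SkewPoly σ δ) := ⟨fun f g => act δ (mulVar δ) f g⟩

instance : One (SkewPoly σ δ) := ⟨term δ 1 1⟩

theorem mul_def (f g : SkewPoly σ δ) : f * g = act δ (mulVar δ) f g := rfl

theorem one_def : (1 : SkewPoly σ δ) = term δ 1 1 := rfl

instance : Ring (SkewPoly σ δ) :=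
  { (inferInstance : AddCommGroup (SkewPoly σ δ)) with
    mul := (· * ·)
    one := 1
    left_distrib := fun f g h => map_add (act δ (mulVar δ) f) g h
    right_distrib := fun f g h => by
      show act δ (mulVar δ) (f + g) h = _
      rw [map_add]; rfl
    zero_mul := fun f => by
      show act δ (mulVar δ) 0 f = 0
      rw [map_zero]; rfl
    mul_zero := fun f => map_zero (act δ (mulVar δ) f)
    mul_assoc := fun f g h => act_act obeys_mulVar f g h
    one_mul := fun f => act_one_left (mulVar δ) f
    mul_one := fun f => act_one_right f }

/-- `F[x; σ, δ]` is a left `F`-algebra: its product is left linear in the first factor. -/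
instance : IsScalarTower F (SkewPoly σ δ) (SkewPoly σ δ) where
  smul_assoc c f g := by
    show act δ (mulVar δ) (c • f) g = c • act δ (mulVar δ) f g
    rw [map_smul]; rfl

/-- The constant `c`, as a skew polynomial. -/
def C (δ : SkewDerivation σ) (c : F) : SkewPoly σ δ := term δ 1 c

/-- The variable `xᵢ`. -/
def X (δ : SkewDerivation σ) (i : Fin n) : SkewPoly σ δ := term δ (FreeMonoid.of i) 1

/-- The product appends monomials. -/
theorem term_mul_term_one (m k : FreeMonoid (Fin n)) (c : F) :
    term δ m c * term δ k 1 = term δ (m * k) c := by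
  rw [mul_def, act_term, word_one, smul_term, mul_one]

/-- The defining rule `xᵢ c = ∑ⱼ σᵢⱼ(c) xⱼ + δᵢ(c)`. -/
theorem X_mul_C (i : Fin n) (c : F) :
    X δ i * C δ c = ∑ j, C δ (σ c i j) * X δ j + C δ (δ c i) := by
  have h : X δ i * C δ c = mulVar δ i (C δ c) := by
    rw [mul_def, X, act_term, one_smul, FreeMonoid.lift_eval_of]
  rw [h, C, mulVar_term]
  simp only [C, X, term_mul_term_one, one_mul, mul_one]

end Ring

section Points

variable {F : Type u} [DivisionRing F] {n : ℕ} {σ : F →+* Matrix (Fin n) (Fin n) F}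
  {δ : SkewDerivation σ}

/-- The operator `𝒟_𝐚 : F → Fⁿ`, `𝒟_𝐚(β) = σ(β) 𝐚 + δ(β)`. -/
def opD (δ : SkewDerivation σ) (a : Fin n → F) (β : F) : Fin n → F :=
  Matrix.mulVec (σ β) a + δ β

theorem opD_apply (a : Fin n → F) (β : F) (i : Fin n) :
    opD δ a β i = ∑ j, σ β i j * a j + δ β i := rfl

theorem opD_add (a : Fin n → F) (β γ : F) : opD δ a (β + γ) = opD δ a β + opD δ a γ := by
  simp only [opD, map_add, Matrix.add_mulVec]
  abel

theorem opD_zero (a : Fin n → F) : opD δ a 0 = 0 := by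
  simp [opD, SkewDerivation.map_zero]

theorem opD_one (a : Fin n → F) : opD δ a 1 = a := by
  simp [opD, SkewDerivation.map_one]

theorem opD_mul (a : Fin n → F) (β γ : F) (i : Fin n) :
    opD δ a (β * γ) i = ∑ j, σ β i j * opD δ a γ j + δ β i * γ := by
  simp only [opD_apply, SkewDerivation.map_mul, map_mul_apply, mul_add, Finset.sum_add_distrib,
    Finset.sum_mul, Finset.mul_sum, mul_assoc]
  rw [Finset.sum_comm]
  abel

/-- The component `𝒟_𝐚^{xᵢ} : F → F` of `𝒟_𝐚`. -/
def opVar (δ : SkewDerivation σ) (a : Fin n → F) (i : Fin n) : AddMonoid.End F where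
  toFun β := opD δ a β i
  map_zero' := by rw [opD_zero]; rfl
  map_add' β γ := by rw [opD_add]; rfl

theorem obeys_opVar (a : Fin n → F) : Obeys δ (opVar δ a) :=
  fun i c w => opD_mul a c w i

/-- The operator `𝒟_𝐚^𝔪 : F → F` of a monomial `𝔪`: it is the identity for `𝔪 = 1`, and
`𝒟_𝐚^{xᵢ𝔪} = 𝒟_𝐚^{xᵢ} ∘ 𝒟_𝐚^𝔪`. -/
def opWord (δ : SkewDerivation σ) (a : Fin n → F) (m : FreeMonoid (Fin n)) : AddMonoid.End F :=
  FreeMonoid.lift (opVar δ a) m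

/-- The map `∑ F_𝔪 𝔪 ↦ ∑ F_𝔪 𝒟_𝐚^𝔪` from skew polynomials to operators on `F`. -/
def toOp (δ : SkewDerivation σ) (a : Fin n → F) : SkewPoly σ δ →+* AddMonoid.End F where
  toFun f := Finsupp.linearCombination F (opWord δ a) f
  map_zero' := map_zero (act δ (opVar δ a))
  map_add' := map_add (act δ (opVar δ a))
  map_one' := AddMonoidHom.ext fun w => act_one_left (opVar δ a) w
  map_mul' f g := AddMonoidHom.ext fun w => act_act (obeys_opVar a) f g w

/-- The left vector space `F[𝒟_𝐚]` of linearized polynomials, that is, the left span of the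
operators `𝒟_𝐚^𝔪`. It is closed under composition, which is its product. -/
def LinPoly (δ : SkewDerivation σ) (a : Fin n → F) : Subring (AddMonoid.End F) :=
  (toOp δ a).range.copy
    (Submodule.span F (Set.range (opWord δ a)) : Submodule F (AddMonoid.End F))
    (by
      rw [← Finsupp.range_linearCombination]
      rfl)

theorem mem_LinPoly {a : Fin n → F} {T : AddMonoid.End F} :
    T ∈ LinPoly δ a ↔ T ∈ Submodule.span F (Set.range (opWord δ a)) := Iff.rfl

theorem toOp_mem (a : Fin n → F) (f : SkewPoly σ δ) : toOp δ a f ∈ LinPoly δ a := by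
  rw [mem_LinPoly, ← Finsupp.range_linearCombination]
  exact ⟨f, rfl⟩

/-- The surjection `φ_𝐚 : F[x; σ, δ] → F[𝒟_𝐚]`, `F ↦ F^{𝒟_𝐚}`, where
`(∑ F_𝔪 𝔪)^{𝒟_𝐚} = ∑ F_𝔪 𝒟_𝐚^𝔪`. -/
def phi (δ : SkewDerivation σ) (a : Fin n → F) : SkewPoly σ δ →+* LinPoly δ a :=
  (toOp δ a).codRestrict (LinPoly δ a) (toOp_mem a)

/-- The left `F`-vector space structure of `F[𝒟_𝐚]`: `(c T)(β) = c T(β)`. -/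
instance (a : Fin n → F) : Module F (LinPoly δ a) :=
  inferInstanceAs
    (Module F (Submodule.span F (Set.range (opWord δ a)) : Submodule F (AddMonoid.End F)))

theorem smul_LinPoly_apply {a : Fin n → F} (c : F) (T : LinPoly δ a) (β : F) :
    ((c • T : LinPoly δ a) : AddMonoid.End F) β = c * (T : AddMonoid.End F) β := rfl

instance (a : Fin n → F) : IsScalarTower F (LinPoly δ a) (LinPoly δ a) where
  smul_assoc _ _ _ := rfl

/-- The remainder ideal `(x₁ - a₁, …, xₙ - aₙ)`, a left ideal. -/
def pointIdeal (δ : SkewDerivation σ) (a : Fin n → F) : Ideal (SkewPoly σ δ) :=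
  Ideal.span (Set.range fun i => X δ i - C δ (a i))

theorem toOp_C (a : Fin n → F) (c β : F) : toOp δ a (C δ c) β = c * β := by
  have h : toOp δ a (C δ c) β = c • FreeMonoid.lift (opVar δ a) 1 β :=
    act_term (opVar δ a) 1 c β
  rw [h, map_one]; rfl

theorem toOp_X (a : Fin n → F) (i : Fin n) (β : F) : toOp δ a (X δ i) β = opD δ a β i := by
  have h : toOp δ a (X δ i) β = (1 : F) • FreeMonoid.lift (opVar δ a) (FreeMonoid.of i) β :=
    act_term (opVar δ a) _ 1 β
  rw [h, one_smul, FreeMonoid.lift_eval_of]; rfl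

theorem toOp_eq_zero_of_mem (a : Fin n → F) {f : SkewPoly σ δ} (hf : f ∈ pointIdeal δ a) :
    toOp δ a f 1 = 0 := by
  induction hf using Submodule.span_induction with
  | mem f h =>
    obtain ⟨i, rfl⟩ := h
    rw [map_sub, End_sub_apply, toOp_X, toOp_C, opD_one, mul_one, sub_self]
  | zero => rw [map_zero]; rfl
  | add f g _ _ hf hg =>
    rw [map_add, End_add_apply, hf, hg, add_zero]
  | smul g f _ hf => rw [smul_eq_mul, map_mul, End_mul_apply, hf, map_zero]

theorem C_add (c d : F) : C δ (c + d) = C δ c + C δ d := term_add 1 c d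

theorem C_zero : C δ 0 = 0 := term_zero 1

theorem C_mul_eq_smul (c : F) (f : SkewPoly σ δ) : C δ c * f = c • f := by
  rw [mul_def, C, act_term, map_one]; rfl

theorem smul_C (c d : F) : c • C δ d = C δ (c * d) := smul_term 1 c d

theorem X_mul_C_sub_mem (a : Fin n → F) (i : Fin n) (c : F) :
    X δ i * C δ c - C δ (opD δ a c i) ∈ pointIdeal δ a := by
  have hC : ∀ (s : Finset (Fin n)) (v : Fin n → F),
      C δ (∑ j ∈ s, v j) = ∑ j ∈ s, C δ (v j) := fun s v =>
    map_sum (Finsupp.singleAddHom (1 : FreeMonoid (Fin n))) v s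
  have h : X δ i * C δ c - C δ (opD δ a c i) =
      ∑ j, C δ (σ c i j) * (X δ j - C δ (a j)) := by
    rw [X_mul_C, opD_apply, C_add, hC, add_sub_add_right_eq_sub, ← Finset.sum_sub_distrib]
    refine Finset.sum_congr rfl fun j _ => ?_
    rw [mul_sub, C_mul_eq_smul _ (C δ (a j)), smul_C]
  rw [h]
  exact Submodule.sum_mem _ fun j _ =>
    Ideal.mul_mem_left _ _ (Submodule.subset_span ⟨j, rfl⟩)

theorem sub_C_mem (a : Fin n → F) (f : SkewPoly σ δ) :
    f - C δ (toOp δ a f 1) ∈ pointIdeal δ a := by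
  induction f using SkewPoly.induction with
  | h0 =>
    have h : toOp δ a (0 : SkewPoly σ δ) 1 = 0 := by rw [map_zero]; rfl
    rw [h, C_zero, sub_zero]
    exact Submodule.zero_mem _
  | hadd f g hf hg =>
    have h : toOp δ a (f + g) 1 = toOp δ a f 1 + toOp δ a g 1 := by rw [map_add]; rfl
    rw [h, C_add, add_sub_add_comm]
    exact Submodule.add_mem _ hf hg
  | ht m c =>
    have key : ∀ m : FreeMonoid (Fin n),
        term δ m 1 - C δ (toOp δ a (term δ m 1) 1) ∈ pointIdeal δ a := by
      intro m
      induction m using FreeMonoid.inductionOn' with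
      | one =>
        have h : toOp δ a (term δ 1 1) 1 = 1 := act_one_left (opVar δ a) 1
        rw [h, C, sub_self]
        exact Submodule.zero_mem _
      | of_mul i m ih =>
        have hm : term δ (FreeMonoid.of i * m) 1 = X δ i * term δ m 1 := by
          rw [X, term_mul_term_one]
        rw [hm, map_mul, End_mul_apply, toOp_X]
        have h1 := Ideal.mul_mem_left _ (X δ i) ih
        rw [mul_sub] at h1
        have h2 := Submodule.add_mem _ h1
          (X_mul_C_sub_mem a i (toOp δ a (term δ m 1) 1))
        rwa [sub_add_sub_cancel] at h2
    have hm : term δ m c = C δ c * term δ m 1 := by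
      rw [C, term_mul_term_one, one_mul]
    have h1 := Ideal.mul_mem_left _ (C δ c) (key m)
    rw [mul_sub] at h1
    rw [hm, map_mul, End_mul_apply, toOp_C]
    convert h1 using 2
    rw [C_mul_eq_smul, smul_C]

/-- Remainders exist and are unique. -/
theorem existsUnique_eval (a : Fin n → F) (f : SkewPoly σ δ) :
    ∃! c : F, f - C δ c ∈ pointIdeal δ a := by
  refine ⟨toOp δ a f 1, sub_C_mem a f, fun c hc => ?_⟩
  have h := toOp_eq_zero_of_mem a hc
  have h2 : toOp δ a (f - C δ c) 1 = toOp δ a f 1 - toOp δ a (C δ c) 1 := by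
    rw [map_sub]; rfl
  rw [h2, toOp_C, mul_one, sub_eq_zero] at h
  exact h.symm

/-- The skew evaluation `F(𝐚)`: the unique `c ∈ F` with `F - c ∈ (x₁ - a₁, …, xₙ - aₙ)`. -/
def eval (a : Fin n → F) (f : SkewPoly σ δ) : F := (existsUnique_eval a f).choose

theorem eval_spec (a : Fin n → F) (f : SkewPoly σ δ) : f - C δ (eval a f) ∈ pointIdeal δ a :=
  (existsUnique_eval a f).choose_spec.1

theorem eval_eq_zero_iff {a : Fin n → F} {f : SkewPoly σ δ} :
    eval a f = 0 ↔ f ∈ pointIdeal δ a := by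
  constructor
  · intro h
    have h1 := eval_spec a f
    rwa [h, C_zero, sub_zero] at h1
  · intro h
    refine (existsUnique_eval a f).unique (eval_spec a f) ?_
    rwa [C_zero, sub_zero]

/-- The left ideal `I(Ω)` of the skew polynomials that vanish on `Ω`. -/
def vanishingIdeal (δ : SkewDerivation σ) (Ω : Set (Fin n → F)) : Ideal (SkewPoly σ δ) where
  carrier := {f | ∀ a ∈ Ω, eval a f = 0}
  zero_mem' _ _ := eval_eq_zero_iff.2 (Submodule.zero_mem _)
  add_mem' hf hg a ha := eval_eq_zero_iff.2
    (Submodule.add_mem _ (eval_eq_zero_iff.1 (hf a ha)) (eval_eq_zero_iff.1 (hg a ha)))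
  smul_mem' c _ hf a ha := eval_eq_zero_iff.2
    (Submodule.smul_mem _ c (eval_eq_zero_iff.1 (hf a ha)))

/-- The zero set `Z(𝒜)`. -/
def zeroSet (A : Set (SkewPoly σ δ)) : Set (Fin n → F) := {a | ∀ f ∈ A, eval a f = 0}

/-- The P-closure `Z(I(Ω))`. -/
def pClosure (δ : SkewDerivation σ) (Ω : Set (Fin n → F)) : Set (Fin n → F) :=
  zeroSet (vanishingIdeal δ Ω : Set (SkewPoly σ δ))

/-- P-closed sets. -/
def IsPClosed (δ : SkewDerivation σ) (Ω : Set (Fin n → F)) : Prop := pClosure δ Ω = Ω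

/-- `Ω` has a finite set of P-generators. -/
def IsPFinGen (δ : SkewDerivation σ) (Ω : Set (Fin n → F)) : Prop :=
  ∃ G ⊆ Ω, G.Finite ∧ pClosure δ G = Ω

/-- P-independent sets. -/
def IsPIndep (δ : SkewDerivation σ) (B : Set (Fin n → F)) : Prop :=
  ∀ a ∈ B, a ∉ pClosure δ (B \ {a})

/-- `B` is a P-basis of `Ω`: a P-independent set of P-generators. -/
def IsPBasis (δ : SkewDerivation σ) (B Ω : Set (Fin n → F)) : Prop :=
  B ⊆ Ω ∧ IsPIndep δ B ∧ pClosure δ B = Ω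

/-- The rank `Rk(Ω)` of a finitely generated P-closed set: the number of elements of a
P-basis. (All its P-bases are finite of the same size, so that the infimum is that size.) -/
def pRank (δ : SkewDerivation σ) (Ω : Set (Fin n → F)) : ℕ :=
  sInf {k | ∃ B, IsPBasis δ B Ω ∧ B.Finite ∧ B.ncard = k}

/-- The conjugate `𝐚^β = 𝒟_𝐚(β) β⁻¹` (used for `β ≠ 0`). -/
def conj (δ : SkewDerivation σ) (a : Fin n → F) (β : F) : Fin n → F :=
  fun i => opD δ a β i * β⁻¹

/-- The conjugacy class `𝒞(𝐚)`. -/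
def conjClass (δ : SkewDerivation σ) (a : Fin n → F) : Set (Fin n → F) :=
  {b | ∃ β : F, β ≠ 0 ∧ b = conj δ a β}

theorem opD_mul_of_mem {a : Fin n → F} (β : F) {γ : F} (hγ : opD δ a γ = fun i => a i * γ) :
    opD δ a (β * γ) = fun i => opD δ a β i * γ := by
  funext i
  rw [opD_mul, hγ, opD_apply, add_mul, Finset.sum_mul]
  simp only [mul_assoc]

/-- The centralizer `K_𝐚 = {β | 𝒟_𝐚(β) = 𝐚 β}`, a division subring of `F`. -/
def centralizer (δ : SkewDerivation σ) (a : Fin n → F) : Subfield F where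
  carrier := {β | opD δ a β = fun i => a i * β}
  mul_mem' {β γ} hβ hγ := by
    simp only [Set.mem_ofPred_eq] at hβ hγ ⊢
    rw [opD_mul_of_mem β hγ, hβ]
    simp only [mul_assoc]
  one_mem' := by simp [opD_one]
  add_mem' {β γ} hβ hγ := by
    simp only [Set.mem_ofPred_eq] at hβ hγ ⊢
    rw [opD_add, hβ, hγ]
    funext i
    simp [mul_add]
  zero_mem' := by
    simp only [Set.mem_ofPred_eq, opD_zero, mul_zero]
    rfl
  neg_mem' {β} hβ := by
    simp only [Set.mem_ofPred_eq] at hβ ⊢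
    have h := opD_add (δ := δ) a β (-β)
    rw [add_neg_cancel, opD_zero, hβ] at h
    rw [eq_neg_of_add_eq_zero_right h.symm]
    funext i
    simp
  inv_mem' β hβ := by
    rcases eq_or_ne β 0 with rfl | h0
    · rwa [inv_zero]
    · have hβ' : opD δ a β = fun i => a i * β := hβ
      have h := opD_mul_of_mem (δ := δ) β⁻¹ hβ'
      rw [inv_mul_cancel₀ h0, opD_one] at h
      show opD δ a β⁻¹ = fun i => a i * β⁻¹
      funext i
      have hi := congrFun h i
      rw [hi, mul_assoc, mul_inv_cancel₀ h0, mul_one]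

/-- `F` as a right vector space over `K_𝐚`, that is, a left one over the opposite ring. -/
instance (a : Fin n → F) : Module (↥(centralizer δ a))ᵐᵒᵖ F :=
  Module.compHom F (RingHom.op (centralizer δ a).subtype)

theorem op_smul_eq {a : Fin n → F} (k : centralizer δ a) (β : F) :
    MulOpposite.op k • β = β * (k : F) := rfl

/-- The right `K_𝐚`-subspace `Ω^𝒟` of `F` that corresponds to `Ω ⊆ 𝒞(𝐚)`: the one generated by
the `β ≠ 0` with `𝐚^β ∈ Ω`. -/
def linSpace (δ : SkewDerivation σ) (a : Fin n → F) (Ω : Set (Fin n → F)) :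
    Submodule (↥(centralizer δ a))ᵐᵒᵖ F :=
  Submodule.span _ {β : F | β ≠ 0 ∧ conj δ a β ∈ Ω}

/-- The left ideal `I(V)` of `F[𝒟_𝐚]` of the linearized polynomials that vanish on a right
`K_𝐚`-subspace `V` of `F`. -/
def linIdeal (δ : SkewDerivation σ) (a : Fin n → F)
    (V : Submodule (↥(centralizer δ a))ᵐᵒᵖ F) : Ideal (LinPoly δ a) where
  carrier := {T | ∀ β ∈ V, (T : AddMonoid.End F) β = 0}
  zero_mem' _ _ := rfl
  add_mem' {S T} hS hT β hβ := by
    show (S : AddMonoid.End F) β + (T : AddMonoid.End F) β = 0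
    rw [hS β hβ, hT β hβ, add_zero]
  smul_mem' S T hT β hβ := by
    show (S : AddMonoid.End F) ((T : AddMonoid.End F) β) = 0
    rw [hT β hβ, map_zero]

end Points

end

end SkewPolys

open SkewPolys

/-!
If `𝒟_𝐚(β) = 𝐛 β`, right multiplication by `β` carries the operators of `𝐛` to those of `𝐚`, so that
`f^{𝒟_𝐚}(β) = f(𝐛) β`: evaluating `f` on the conjugacy class of `𝐚` amounts to applying the operator
`f^{𝒟_𝐚}` to scalars.

Let `B` be a finite P-independent set, let `e_𝐜` (`𝐜 ∈ B`) be polynomials dual to the points of `B`,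
and let `𝐛` lie in the P-closure of `B`. The polynomials `(xᵢ - 𝐜ᵢ) e_𝐜` and `1 - ∑ e_𝐜` vanish on
`B`, hence at `𝐛`; so the scalars `k_𝐜 = e_𝐜(𝐛)` satisfy `𝒟_𝐛(k_𝐜) = 𝐜 k_𝐜` and `∑ k_𝐜 = 1`.
Applying `f^{𝒟_𝐛}` to this decomposition of `1` shows that `𝐛` is already in the P-closure of the
points of `B` conjugate to it: P-bases, and with them ranks, split along conjugacy classes.
Multiplying it by `β` with `𝐛 = 𝐚^β` shows that representatives in `F` of the points of a P-basis of
`Ω ⊆ 𝒞(𝐚)` form a basis of `Ω^𝒟`. Finally `Rk(Ω) = dim R/I(Ω)`, so the first map is an injection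
between spaces of equal finite dimension.
-/

namespace SkewPolys

variable {F : Type u} [DivisionRing F] {n : ℕ} {σ : F →+* Matrix (Fin n) (Fin n) F}
  {δ : SkewDerivation σ} {a b c : Fin n → F} {β γ : F} {S T B Ω : Set (Fin n → F)}

theorem eval_eq_toOp_one (a : Fin n → F) (f : SkewPoly σ δ) : eval a f = toOp δ a f 1 :=
  (existsUnique_eval a f).unique (eval_spec a f) (sub_C_mem a f)

theorem eval_mul (a : Fin n → F) (f g : SkewPoly σ δ) :
    eval a (f * g) = toOp δ a f (eval a g) := by
  rw [eval_eq_toOp_one, eval_eq_toOp_one, map_mul, End_mul_apply]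

theorem toOp_smul_apply (a : Fin n → F) (k : F) (f : SkewPoly σ δ) (β : F) :
    toOp δ a (k • f) β = k * toOp δ a f β := by
  rw [← C_mul_eq_smul, map_mul, End_mul_apply, toOp_C]

theorem toOp_term (a : Fin n → F) (m : FreeMonoid (Fin n)) (k β : F) :
    toOp δ a (term δ m k) β = k * opWord δ a m β :=
  act_term (opVar δ a) m k β

theorem opWord_of_mul (a : Fin n → F) (i : Fin n) (m : FreeMonoid (Fin n)) (β : F) :
    opWord δ a (FreeMonoid.of i * m) β = opVar δ a i (opWord δ a m β) := by
  rw [opWord, map_mul (FreeMonoid.lift _), FreeMonoid.lift_eval_of, End_mul_apply, ← opWord]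

/-- Evaluation at `a` as a left `F`-linear functional on `F[x; σ, δ]`. -/
noncomputable def evalLin (δ : SkewDerivation σ) (a : Fin n → F) : SkewPoly σ δ →ₗ[F] F where
  toFun := eval a
  map_add' f g := by simp only [eval_eq_toOp_one, map_add, End_add_apply]
  map_smul' k f := by simp only [eval_eq_toOp_one, toOp_smul_apply, RingHom.id_apply, smul_eq_mul]

theorem evalLin_apply (a : Fin n → F) (f : SkewPoly σ δ) : evalLin δ a f = eval a f := rfl

theorem evalLin_one (a : Fin n → F) : evalLin δ a 1 = 1 := by
  rw [evalLin_apply, eval_eq_toOp_one, map_one (toOp δ a), AddMonoid.End.coe_one, id_eq]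

/-- `𝒟_𝐚(β) = 𝐛 β`. For `β ≠ 0` this says that `𝐛` is the conjugate `𝐚^β`, and for `𝐛 = 𝐚` that
`β ∈ K_𝐚`. Right multiplication by such a `β` intertwines the operators of `𝐛` and `𝐚`; unlike the
conjugate, the relation is meaningful for `β = 0`. -/
def Intertwines (δ : SkewDerivation σ) (a b : Fin n → F) (β : F) : Prop :=
  opD δ a β = fun i => b i * β

theorem mem_centralizer_iff : β ∈ centralizer δ a ↔ Intertwines δ a a β := Iff.rfl

theorem intertwines_conj (a : Fin n → F) (hβ : β ≠ 0) : Intertwines δ a (conj δ a β) β :=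
  funext fun i => (inv_mul_cancel_right₀ hβ (opD δ a β i)).symm

namespace Intertwines

theorem eq_conj (h : Intertwines δ a b β) (hβ : β ≠ 0) : b = conj δ a β := by
  funext i
  rw [conj, h, mul_inv_cancel_right₀ hβ]

theorem opD_mul (h : Intertwines δ a b β) (γ : F) (i : Fin n) :
    opD δ a (γ * β) i = opD δ b γ i * β := by
  rw [SkewPolys.opD_mul, show opD δ a β = _ from h, opD_apply, add_mul, Finset.sum_mul]
  simp only [mul_assoc]

theorem mul (hβ : Intertwines δ a b β) (hγ : Intertwines δ b c γ) :
    Intertwines δ a c (γ * β) := by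
  funext i
  rw [hβ.opD_mul, hγ, mul_assoc]

theorem inv (h : Intertwines δ a b β) (hβ : β ≠ 0) : Intertwines δ b a β⁻¹ := by
  funext i
  rw [eq_mul_inv_iff_mul_eq₀ hβ, ← h.opD_mul, inv_mul_cancel₀ hβ, opD_one]

theorem opWord_mul (h : Intertwines δ a b β) (m : FreeMonoid (Fin n)) (γ : F) :
    opWord δ a m (γ * β) = opWord δ b m γ * β := by
  induction m using FreeMonoid.inductionOn' with
  | one => rw [opWord, map_one (FreeMonoid.lift _), opWord, map_one (FreeMonoid.lift _)]; rfl
  | of_mul i m ih =>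
    rw [opWord_of_mul, ih, opWord_of_mul]
    exact h.opD_mul _ i

theorem toOp_mul (h : Intertwines δ a b β) (f : SkewPoly σ δ) (γ : F) :
    toOp δ a f (γ * β) = toOp δ b f γ * β := by
  induction f using SkewPoly.induction with
  | h0 => rw [map_zero, map_zero]; exact (zero_mul β).symm
  | hadd f g hf hg => rw [map_add, map_add, End_add_apply, End_add_apply, hf, hg, add_mul]
  | ht m k => rw [toOp_term, toOp_term, h.opWord_mul, mul_assoc]

theorem toOp_apply (h : Intertwines δ a b β) (f : SkewPoly σ δ) :
    toOp δ a f β = eval b f * β := by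
  rw [eval_eq_toOp_one, ← h.toOp_mul, one_mul]

end Intertwines

theorem mem_conjClass_iff : b ∈ conjClass δ a ↔ ∃ β ≠ 0, Intertwines δ a b β :=
  exists_congr fun _ => and_congr_right fun hβ =>
    ⟨fun h => h ▸ intertwines_conj a hβ, fun h => h.eq_conj hβ⟩

theorem mem_conjClass_symm (h : b ∈ conjClass δ a) : a ∈ conjClass δ b := by
  obtain ⟨β, hβ, h⟩ := mem_conjClass_iff.1 h
  exact mem_conjClass_iff.2 ⟨β⁻¹, inv_ne_zero hβ, h.inv hβ⟩

theorem mem_conjClass_trans (hb : b ∈ conjClass δ a) (hc : c ∈ conjClass δ b) :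
    c ∈ conjClass δ a := by
  obtain ⟨β, hβ, hb⟩ := mem_conjClass_iff.1 hb
  obtain ⟨γ, hγ, hc⟩ := mem_conjClass_iff.1 hc
  exact mem_conjClass_iff.2 ⟨γ * β, mul_ne_zero hγ hβ, hb.mul hc⟩

theorem conjClass_eq_of_mem (h : b ∈ conjClass δ a) : conjClass δ b = conjClass δ a :=
  Set.Subset.antisymm (fun _ => mem_conjClass_trans h)
    fun _ => mem_conjClass_trans (mem_conjClass_symm h)

theorem subset_pClosure_iff : S ⊆ pClosure δ T ↔ vanishingIdeal δ T ≤ vanishingIdeal δ S :=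
  ⟨fun h f hf _ ha => h ha f hf, fun h _ ha _ hf => h hf _ ha⟩

theorem vanishingIdeal_anti (h : S ⊆ T) : vanishingIdeal δ T ≤ vanishingIdeal δ S :=
  fun _ hf _ ha => hf _ (h ha)

theorem pClosure_mono (h : S ⊆ T) : pClosure δ S ⊆ pClosure δ T :=
  fun _ hb _ hf => hb _ (vanishingIdeal_anti h hf)

theorem subset_pClosure : S ⊆ pClosure δ S := subset_pClosure_iff.2 le_rfl

theorem vanishingIdeal_pClosure : vanishingIdeal δ (pClosure δ S) = vanishingIdeal δ S :=
  le_antisymm (vanishingIdeal_anti subset_pClosure) (subset_pClosure_iff.1 subset_rfl)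

theorem isPClosed_pClosure : IsPClosed δ (pClosure δ S) := by
  rw [IsPClosed, pClosure, vanishingIdeal_pClosure, ← pClosure]

theorem pClosure_subset_pClosure_iff : pClosure δ S ⊆ pClosure δ T ↔ S ⊆ pClosure δ T := by
  rw [subset_pClosure_iff, vanishingIdeal_pClosure, ← subset_pClosure_iff]

theorem pClosure_empty : pClosure δ ∅ = ∅ :=
  Set.eq_empty_of_forall_notMem fun b hb =>
    one_ne_zero ((evalLin_one b).symm.trans (hb 1 fun _ => False.elim))

theorem notMem_pClosure_iff :
    b ∉ pClosure δ S ↔ ∃ f : SkewPoly σ δ, eval b f = 1 ∧ ∀ c ∈ S, eval c f = 0 := by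
  refine ⟨fun hb => ?_, fun ⟨f, hfb, hfS⟩ hb => one_ne_zero (hfb.symm.trans (hb f hfS))⟩
  obtain ⟨f, hfS, hfb⟩ : ∃ f ∈ vanishingIdeal δ S, evalLin δ b f ≠ 0 := by
    by_contra! h
    exact hb h
  refine ⟨(evalLin δ b f)⁻¹ • f, ?_, fun c hc => ?_⟩
  · rw [← evalLin_apply, map_smul, smul_eq_mul, inv_mul_cancel₀ hfb]
  · rw [← evalLin_apply, map_smul, evalLin_apply c, hfS c hc, smul_zero]

theorem IsPFinGen.isPClosed (h : IsPFinGen δ Ω) : IsPClosed δ Ω := by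
  obtain ⟨G, _, _, rfl⟩ := h
  exact isPClosed_pClosure

theorem IsPBasis.isPFinGen (hB : IsPBasis δ B Ω) (hfin : B.Finite) : IsPFinGen δ Ω :=
  ⟨B, hB.1, hfin, hB.2.2⟩

theorem IsPIndep.mono (hT : IsPIndep δ T) (h : S ⊆ T) : IsPIndep δ S :=
  fun _ hb hbS => hT _ (h hb) (pClosure_mono (Set.sdiff_subset_sdiff_left h) hbS)

theorem IsPFinGen.exists_finite_isPBasis (h : IsPFinGen δ Ω) :
    ∃ B, B.Finite ∧ IsPBasis δ B Ω := by
  obtain ⟨G, hGΩ, hfin, hG⟩ := h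
  obtain ⟨B, ⟨hBG, hB⟩, hmin⟩ :=
    (hfin.finite_subsets.subset fun _ hB => hB.1 :
      {B | B ⊆ G ∧ pClosure δ B = Ω}.Finite).exists_minimal ⟨G, subset_rfl, hG⟩
  refine ⟨B, hfin.subset hBG, hBG.trans hGΩ, fun b hbB hb => ?_, hB⟩
  have hsub : B \ {b} ⊆ B := Set.sdiff_subset
  have hcl : pClosure δ (B \ {b}) = pClosure δ B := by
    refine (pClosure_mono hsub).antisymm (pClosure_subset_pClosure_iff.2 fun c hc => ?_)
    obtain rfl | hcb := eq_or_ne c b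
    exacts [hb, subset_pClosure ⟨hc, hcb⟩]
  exact (hmin ⟨hsub.trans hBG, hcl.trans hB⟩ hsub hbB).2 rfl

theorem IsPFinGen.exists_isPBasis (h : IsPFinGen δ Ω) : ∃ B, IsPBasis δ B Ω :=
  h.exists_finite_isPBasis.imp fun _ => And.right

theorem IsPIndep.exists_dual [DecidableEq B] (hB : IsPIndep δ B) :
    ∃ e : B → SkewPoly σ δ, ∀ b c : B, evalLin δ c (e b) = (Pi.single b 1 : B → F) c := by
  choose e he using fun b : B => notMem_pClosure_iff.1 (hB b b.2)
  refine ⟨e, fun b c => ?_⟩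
  obtain rfl | hcb := eq_or_ne c b
  · rw [Pi.single_eq_same, evalLin_apply, (he c).1]
  · rw [Pi.single_eq_of_ne hcb, evalLin_apply]
    exact (he b).2 c ⟨c.2, fun h => hcb (Subtype.ext h)⟩

/-- The simultaneous evaluation of skew polynomials at all points of `S`. -/
noncomputable def evalOn (δ : SkewDerivation σ) (S : Set (Fin n → F)) :
    SkewPoly σ δ →ₗ[F] (S → F) :=
  LinearMap.pi fun b => evalLin δ b

theorem ker_evalOn : (evalOn δ S).ker = (vanishingIdeal δ S).restrictScalars F := by
  ext f
  exact funext_iff.trans Subtype.forall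

/-- The space of value tables on `S` realized by skew polynomials, as `F[x; σ, δ] / I(S)`. -/
noncomputable def quotientEquivRange (δ : SkewDerivation σ) (S : Set (Fin n → F)) :
    (SkewPoly σ δ ⧸ vanishingIdeal δ S) ≃ₗ[F] (evalOn δ S).range :=
  (Submodule.Quotient.restrictScalarsEquiv F (vanishingIdeal δ S)).symm ≪≫ₗ
    Submodule.quotEquivOfEq _ _ ker_evalOn.symm ≪≫ₗ (evalOn δ S).quotKerEquivRange

theorem rank_quotient_le_ncard (hS : S.Finite) :
    Module.rank F (SkewPoly σ δ ⧸ vanishingIdeal δ S) ≤ S.ncard := by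
  have := hS.fintype
  rw [(quotientEquivRange δ S).rank_eq, ← Nat.card_coe_set_eq, Nat.card_eq_fintype_card,
    ← rank_fun' (R := F)]
  exact Submodule.rank_le _

theorem IsPIndep.mk_le_rank_quotient (hB : IsPIndep δ B) :
    Cardinal.mk B ≤ Module.rank F (SkewPoly σ δ ⧸ vanishingIdeal δ B) := by
  classical
  obtain ⟨e, he⟩ := hB.exists_dual
  have he' (b : B) : evalOn δ B (e b) = Pi.single b 1 := funext (he b)
  let v : B → (evalOn δ B).range := fun b => (evalOn δ B).rangeRestrict (e b)
  have hv : LinearIndependent F v := by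
    refine LinearIndependent.of_comp (evalOn δ B).range.subtype ?_
    convert Pi.linearIndependent_single_one B F using 1
    exact funext he'
  exact (quotientEquivRange δ B).rank_eq ▸ hv.cardinal_le_rank

theorem IsPBasis.vanishingIdeal_eq (hB : IsPBasis δ B Ω) :
    vanishingIdeal δ B = vanishingIdeal δ Ω := by
  rw [← hB.2.2, vanishingIdeal_pClosure]

theorem IsPBasis.rank_quotient (hB : IsPBasis δ B Ω) (hfin : B.Finite) :
    Module.rank F (SkewPoly σ δ ⧸ vanishingIdeal δ Ω) = B.ncard := by
  rw [← hB.vanishingIdeal_eq]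
  refine le_antisymm (rank_quotient_le_ncard hfin) ?_
  rw [Set.cast_ncard hfin]
  exact hB.2.1.mk_le_rank_quotient

theorem IsPBasis.ncard_eq_pRank (hB : IsPBasis δ B Ω) (hfin : B.Finite) :
    B.ncard = pRank δ Ω := by
  have hset : {k | ∃ B', IsPBasis δ B' Ω ∧ B'.Finite ∧ B'.ncard = k} = {B.ncard} := by
    refine Set.eq_singleton_iff_unique_mem.2 ⟨⟨B, hB, hfin, rfl⟩, ?_⟩
    rintro _ ⟨B', hB', hfin', rfl⟩
    exact_mod_cast (hB'.rank_quotient hfin').symm.trans (hB.rank_quotient hfin)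
  rw [pRank, hset, csInf_singleton]

theorem IsPFinGen.rank_quotient (h : IsPFinGen δ Ω) :
    Module.rank F (SkewPoly σ δ ⧸ vanishingIdeal δ Ω) = pRank δ Ω := by
  obtain ⟨B, hfin, hB⟩ := h.exists_finite_isPBasis
  rw [hB.rank_quotient hfin, hB.ncard_eq_pRank hfin]

theorem IsPFinGen.finite_quotient (h : IsPFinGen δ Ω) :
    Module.Finite F (SkewPoly σ δ ⧸ vanishingIdeal δ Ω) :=
  Module.rank_lt_aleph0_iff.1 (h.rank_quotient ▸ Cardinal.natCast_lt_aleph0)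

theorem IsPBasis.finite (hB : IsPBasis δ B Ω) (h : IsPFinGen δ Ω) : B.Finite := by
  refine Cardinal.lt_aleph0_iff_set_finite.1 (hB.2.1.mk_le_rank_quotient.trans_lt ?_)
  rw [hB.vanishingIdeal_eq, h.rank_quotient]
  exact Cardinal.natCast_lt_aleph0

theorem IsPBasis.finite_and_ncard_eq_pRank (hB : IsPBasis δ B Ω) (h : IsPFinGen δ Ω) :
    B.Finite ∧ B.ncard = pRank δ Ω :=
  ⟨hB.finite h, hB.ncard_eq_pRank (hB.finite h)⟩

theorem IsPIndep.exists_intertwines_sum_eq_one [Fintype B] (hB : IsPIndep δ B)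
    (hb : b ∈ pClosure δ B) : ∃ k : B → F, (∀ c : B, Intertwines δ b c (k c)) ∧ ∑ c, k c = 1 := by
  classical
  obtain ⟨e, he⟩ := hB.exists_dual
  refine ⟨fun c => evalLin δ b (e c), fun c => funext fun i => ?_, ?_⟩
  · have hvanish : (X δ i - C δ (c.1 i)) * e c ∈ vanishingIdeal δ B := fun d hd => by
      rw [eval_mul, map_sub, End_sub_apply, toOp_X, toOp_C, ← evalLin_apply, he c ⟨d, hd⟩]
      obtain rfl | hdc := eq_or_ne (⟨d, hd⟩ : B) c
      · rw [Pi.single_eq_same, opD_one, mul_one, sub_self]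
      · rw [Pi.single_eq_of_ne hdc, opD_zero, mul_zero, Pi.zero_apply, sub_zero]
    have := hb _ hvanish
    rwa [eval_mul, map_sub, End_sub_apply, toOp_X, toOp_C, sub_eq_zero] at this
  · have hvanish : 1 - ∑ c, e c ∈ vanishingIdeal δ B := fun d hd => by
      rw [← evalLin_apply, map_sub, evalLin_one, map_sum, sub_eq_zero]
      simp only [he _ ⟨d, hd⟩, Finset.sum_pi_single, Finset.mem_univ, if_true]
    have := hb _ hvanish
    rw [← evalLin_apply, map_sub, evalLin_one, map_sum, sub_eq_zero] at this
    exact this.symm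

theorem IsPIndep.mem_pClosure_inter_conjClass (hB : IsPIndep δ B) (hfin : B.Finite)
    (hb : b ∈ pClosure δ B) : b ∈ pClosure δ (B ∩ conjClass δ b) := by
  have := hfin.fintype
  obtain ⟨k, hk, hsum⟩ := hB.exists_intertwines_sum_eq_one hb
  intro f hf
  rw [eval_eq_toOp_one, ← hsum, map_sum]
  refine Finset.sum_eq_zero fun c _ => ?_
  rw [(hk c).toOp_apply]
  obtain h0 | h0 := eq_or_ne (k c) 0
  · rw [h0, mul_zero]
  · rw [hf c ⟨c.2, mem_conjClass_iff.2 ⟨k c, h0, hk c⟩⟩, zero_mul]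

theorem IsPBasis.inter_conjClass (hB : IsPBasis δ B Ω) (hfin : B.Finite) (a : Fin n → F) :
    IsPBasis δ (B ∩ conjClass δ a) (Ω ∩ conjClass δ a) := by
  have hindep := hB.2.1.mono (Set.inter_subset_left (t := conjClass δ a))
  refine ⟨Set.inter_subset_inter_left _ hB.1, hindep, Set.Subset.antisymm (fun b hb => ?_) ?_⟩
  · obtain ⟨c, ⟨_, hca⟩, hcb⟩ : ((B ∩ conjClass δ a) ∩ conjClass δ b).Nonempty := by
      by_contra! h
      have := hindep.mem_pClosure_inter_conjClass (hfin.inter_of_left _) hb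
      rwa [h, pClosure_empty] at this
    exact ⟨hB.2.2 ▸ pClosure_mono Set.inter_subset_left hb,
      mem_conjClass_trans hca (mem_conjClass_symm hcb)⟩
  · rintro b ⟨hbΩ, hba⟩
    rw [← conjClass_eq_of_mem hba]
    exact hB.2.1.mem_pClosure_inter_conjClass hfin (hB.2.2.symm ▸ hbΩ)

theorem IsPFinGen.inter_conjClass (h : IsPFinGen δ Ω) (a : Fin n → F) :
    IsPFinGen δ (Ω ∩ conjClass δ a) :=
  let ⟨_, hfin, hB⟩ := h.exists_finite_isPBasis
  (hB.inter_conjClass hfin a).isPFinGen (hfin.inter_of_left _)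

theorem disjoint_conjClass (h : b ∉ conjClass δ a) :
    Disjoint (conjClass δ a) (conjClass δ b) :=
  Set.disjoint_left.2 fun _ hca hcb => h (mem_conjClass_trans hca (mem_conjClass_symm hcb))

theorem IsPFinGen.pRank_eq_sum {ι : Type*} [Fintype ι] {a : ι → Fin n → F} (h : IsPFinGen δ Ω)
    (ha : Pairwise fun i j => a j ∉ conjClass δ (a i)) (hcover : Ω ⊆ ⋃ i, conjClass δ (a i)) :
    pRank δ Ω = ∑ i, pRank δ (Ω ∩ conjClass δ (a i)) := by
  obtain ⟨B, hfin, hB⟩ := h.exists_finite_isPBasis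
  have hpiece (i : ι) : (B ∩ conjClass δ (a i)).Finite := hfin.inter_of_left _
  have hdisj : Pairwise (Function.onFun Disjoint fun i => B ∩ conjClass δ (a i)) := fun i j hij =>
    (disjoint_conjClass (ha hij)).mono Set.inter_subset_right Set.inter_subset_right
  simp only [← (hB.inter_conjClass hfin _).ncard_eq_pRank (hpiece _), ← hB.ncard_eq_pRank hfin]
  rw [← finsum_eq_sum_of_fintype, ← Set.ncard_iUnion_of_finite hpiece hdisj, ← Set.inter_iUnion,
    Set.inter_eq_self_of_subset_left (hB.1.trans hcover)]

/-- The operator `f^{𝒟_𝐚}` as a right `K_𝐚`-linear map. -/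
noncomputable def toOpLin (δ : SkewDerivation σ) (a : Fin n → F) (f : SkewPoly σ δ) :
    F →ₗ[(centralizer δ a)ᵐᵒᵖ] F where
  toFun := toOp δ a f
  map_add' := map_add (toOp δ a f)
  map_smul' k β := (mem_centralizer_iff.1 k.unop.2).toOp_mul f β

theorem toOpLin_apply (a : Fin n → F) (f : SkewPoly σ δ) (β : F) :
    toOpLin δ a f β = toOp δ a f β := rfl

theorem toOp_eq_zero_iff (hβ : β ≠ 0) (f : SkewPoly σ δ) :
    toOp δ a f β = 0 ↔ eval (conj δ a β) f = 0 := by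
  rw [(intertwines_conj a hβ).toOp_apply, mul_eq_zero, or_iff_left hβ]

theorem mem_linSpace_of_conj_mem (hβ : β ≠ 0) (h : conj δ a β ∈ S) : β ∈ linSpace δ a S :=
  Submodule.subset_span ⟨hβ, h⟩

theorem Intertwines.mem_linSpace (h : Intertwines δ a b β) (hb : b ∈ S) : β ∈ linSpace δ a S := by
  obtain rfl | hβ := eq_or_ne β 0
  · exact zero_mem _
  · exact mem_linSpace_of_conj_mem hβ (h.eq_conj hβ ▸ hb)

theorem linSpace_le_ker_toOpLin_iff (hS : S ⊆ conjClass δ a) {f : SkewPoly σ δ} :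
    linSpace δ a S ≤ (toOpLin δ a f).ker ↔ f ∈ vanishingIdeal δ S := by
  rw [linSpace, Submodule.span_le]
  constructor
  · intro h b hb
    obtain ⟨β, hβ, rfl⟩ := hS hb
    exact (toOp_eq_zero_iff hβ f).1 (h ⟨hβ, hb⟩)
  · rintro h β ⟨hβ, hb⟩
    exact (toOp_eq_zero_iff hβ f).2 (h _ hb)

theorem comap_linIdeal_linSpace (hS : S ⊆ conjClass δ a) :
    (linIdeal δ a (linSpace δ a S)).comap (phi δ a) = vanishingIdeal δ S :=
  Ideal.ext fun _ => linSpace_le_ker_toOpLin_iff hS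

theorem IsPClosed.conj_mem_of_mem_linSpace (hΩ : IsPClosed δ Ω) (h : Ω ⊆ conjClass δ a)
    (hβ : β ≠ 0) (hβΩ : β ∈ linSpace δ a Ω) : conj δ a β ∈ Ω := by
  rw [← hΩ]
  exact fun f hf => (toOp_eq_zero_iff hβ f).1 ((linSpace_le_ker_toOpLin_iff h).2 hf hβΩ)

theorem IsPClosed.eq_conj_linSpace (hΩ : IsPClosed δ Ω) (h : Ω ⊆ conjClass δ a) :
    Ω = {b | ∃ β ∈ linSpace δ a Ω, β ≠ 0 ∧ b = conj δ a β} := by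
  ext b
  constructor
  · intro hb
    obtain ⟨β, hβ, rfl⟩ := h hb
    exact ⟨β, mem_linSpace_of_conj_mem hβ hb, hβ, rfl⟩
  · rintro ⟨β, hβΩ, hβ, rfl⟩
    exact hΩ.conj_mem_of_mem_linSpace h hβ hβΩ

theorem IsPIndep.linSpace_pClosure (hB : IsPIndep δ B) (hfin : B.Finite) (a : Fin n → F) :
    linSpace δ a (pClosure δ B) = linSpace δ a B := by
  have := hfin.fintype
  refine le_antisymm (Submodule.span_le.2 ?_)
    (Submodule.span_mono fun β hβ => ⟨hβ.1, subset_pClosure hβ.2⟩)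
  rintro β ⟨hβ, hb⟩
  obtain ⟨k, hk, hsum⟩ := hB.exists_intertwines_sum_eq_one hb
  rw [← one_mul β, ← hsum, Finset.sum_mul]
  exact Submodule.sum_mem _ fun c _ => ((intertwines_conj a hβ).mul (hk c)).mem_linSpace c.2

theorem Intertwines.exists_op_smul_eq (hβ : Intertwines δ a b β) (hγ : Intertwines δ a b γ)
    (h0 : β ≠ 0) : ∃ k : (centralizer δ a)ᵐᵒᵖ, k • β = γ :=
  ⟨.op ⟨β⁻¹ * γ, mem_centralizer_iff.2 (hγ.mul (hβ.inv h0))⟩, mul_inv_cancel_left₀ h0 γ⟩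

theorem IsPIndep.linearIndependent (hB : IsPIndep δ B) {β : B → F} (hβ0 : ∀ b, β b ≠ 0)
    (hβ : ∀ b : B, Intertwines δ a b (β b)) : LinearIndependent (centralizer δ a)ᵐᵒᵖ β := by
  classical
  obtain ⟨e, he⟩ := hB.exists_dual
  refine linearIndependent_iff'.2 fun s k hk b hb => ?_
  have hdual (c : B) : toOpLin δ a (e b) (β c) = if c = b then β c else 0 := by
    rw [toOpLin_apply, (hβ c).toOp_apply, ← evalLin_apply, he, Pi.single_apply, ite_mul, one_mul,
      zero_mul]
  have hkb : k b • β b = 0 := by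
    have := congrArg (toOpLin δ a (e b)) hk
    simpa only [map_sum, map_smul, hdual, smul_ite, smul_zero, Finset.sum_ite_eq', hb, if_true,
      map_zero] using this
  exact (smul_eq_zero.1 hkb).resolve_right (hβ0 b)

theorem span_range_eq_linSpace {β : S → F} (hβ0 : ∀ b, β b ≠ 0)
    (hβ : ∀ b : S, Intertwines δ a b (β b)) :
    Submodule.span (centralizer δ a)ᵐᵒᵖ (Set.range β) = linSpace δ a S := by
  refine le_antisymm (Submodule.span_le.2 ?_) (Submodule.span_le.2 ?_)
  · rintro _ ⟨b, rfl⟩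
    exact (hβ b).mem_linSpace b.2
  · rintro γ ⟨hγ, hb⟩
    obtain ⟨k, hk⟩ := (hβ ⟨_, hb⟩).exists_op_smul_eq (intertwines_conj a hγ) (hβ0 _)
    exact hk ▸ Submodule.smul_mem _ k (Submodule.subset_span ⟨_, rfl⟩)

theorem IsPFinGen.rank_linSpace (hΩ : IsPFinGen δ Ω) (h : Ω ⊆ conjClass δ a) :
    Module.rank (centralizer δ a)ᵐᵒᵖ (linSpace δ a Ω) = pRank δ Ω := by
  obtain ⟨B, hfin, hB⟩ := hΩ.exists_finite_isPBasis
  have hBa : B ⊆ conjClass δ a := hB.1.trans h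
  choose β hβ0 hβ using fun b : B => mem_conjClass_iff.1 (hBa b.2)
  have hli := hB.2.1.linearIndependent hβ0 hβ
  rw [← hB.2.2, hB.2.1.linSpace_pClosure hfin, ← span_range_eq_linSpace hβ0 hβ,
    rank_span hli, Cardinal.mk_range_eq β hli.injective, ← Set.cast_ncard hfin, hB.2.2,
    hB.ncard_eq_pRank hfin]

theorem IsPFinGen.finite_linSpace (hΩ : IsPFinGen δ Ω) (h : Ω ⊆ conjClass δ a) :
    Module.Finite (centralizer δ a)ᵐᵒᵖ (linSpace δ a Ω) :=
  Module.rank_lt_aleph0_iff.1 (hΩ.rank_linSpace h ▸ Cardinal.natCast_lt_aleph0)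

/-- The `F[x; σ, δ]`-linear map `f + I(Ω) ↦ (f + I(Sᵢ))ᵢ` for a family of subsets `Sᵢ` of `Ω`. -/
noncomputable def restrictQuotient {ι : Type*} {S : ι → Set (Fin n → F)} (h : ∀ i, S i ⊆ Ω) :
    (SkewPoly σ δ ⧸ vanishingIdeal δ Ω) →ₗ[SkewPoly σ δ]
      ∀ i, SkewPoly σ δ ⧸ vanishingIdeal δ (S i) :=
  LinearMap.pi fun i => Submodule.factor (vanishingIdeal_anti (h i))

theorem restrictQuotient_injective {ι : Type*} {S : ι → Set (Fin n → F)} (h : ∀ i, S i ⊆ Ω)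
    (hcover : Ω ⊆ ⋃ i, S i) : Function.Injective (restrictQuotient (δ := δ) h) := by
  refine (injective_iff_map_eq_zero _).2 fun x hx => ?_
  obtain ⟨f, rfl⟩ := Submodule.Quotient.mk_surjective _ x
  refine (Submodule.Quotient.mk_eq_zero _).2 fun b hb => ?_
  obtain ⟨i, hi⟩ := Set.mem_iUnion.1 (hcover hb)
  exact (Submodule.Quotient.mk_eq_zero _).1 (congrFun hx i) b hi

theorem restrictQuotient_bijective {ι : Type*} [Fintype ι] {S : ι → Set (Fin n → F)}
    (hΩ : IsPFinGen δ Ω) (hS : ∀ i, IsPFinGen δ (S i)) (h : ∀ i, S i ⊆ Ω) (hcover : Ω ⊆ ⋃ i, S i)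
    (hrank : pRank δ Ω = ∑ i, pRank δ (S i)) :
    Function.Bijective (restrictQuotient (δ := δ) h) := by
  let T := (restrictQuotient (δ := δ) h).restrictScalars F
  have hinj : Function.Injective T := restrictQuotient_injective h hcover
  have := hΩ.finite_quotient
  have (i : ι) := (hS i).finite_quotient
  refine ⟨hinj, (LinearMap.injective_iff_surjective_of_finrank_eq_finrank ?_).1 hinj⟩
  rw [Module.finrank_pi_fintype, Module.finrank_eq_of_rank_eq hΩ.rank_quotient, hrank]
  exact Finset.sum_congr rfl fun i _ => (Module.finrank_eq_of_rank_eq (hS i).rank_quotient).symm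

/-- The isomorphism `f + I(Ω) ↦ (f + I(Ω ∩ 𝒞(𝐚ᵢ)))ᵢ`. -/
noncomputable def conjClassQuotientEquiv {ι : Type*} [Fintype ι] {a : ι → Fin n → F}
    (hΩ : IsPFinGen δ Ω) (ha : Pairwise fun i j => a j ∉ conjClass δ (a i))
    (hcover : Ω ⊆ ⋃ i, conjClass δ (a i)) :
    (SkewPoly σ δ ⧸ vanishingIdeal δ Ω) ≃ₗ[SkewPoly σ δ]
      ∀ i, SkewPoly σ δ ⧸ vanishingIdeal δ (Ω ∩ conjClass δ (a i)) :=
  LinearEquiv.ofBijective (restrictQuotient fun _ => Set.inter_subset_left)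
    (restrictQuotient_bijective hΩ (fun i => hΩ.inter_conjClass (a i)) _
      (Set.inter_iUnion Ω _ ▸ Set.subset_inter subset_rfl hcover) (hΩ.pRank_eq_sum ha hcover))

theorem conjClassQuotientEquiv_mul {ι : Type*} [Fintype ι] {a : ι → Fin n → F}
    (hΩ : IsPFinGen δ Ω) (ha : Pairwise fun i j => a j ∉ conjClass δ (a i))
    (hcover : Ω ⊆ ⋃ i, conjClass δ (a i)) [(vanishingIdeal δ Ω).IsTwoSided]
    [∀ i, (vanishingIdeal δ (Ω ∩ conjClass δ (a i))).IsTwoSided]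
    (x y : SkewPoly σ δ ⧸ vanishingIdeal δ Ω) :
    conjClassQuotientEquiv hΩ ha hcover (x * y) =
      conjClassQuotientEquiv hΩ ha hcover x * conjClassQuotientEquiv hΩ ha hcover y := by
  obtain ⟨f, rfl⟩ := Submodule.Quotient.mk_surjective _ x
  obtain ⟨g, rfl⟩ := Submodule.Quotient.mk_surjective _ y
  rfl

theorem phi_surjective (a : Fin n → F) : Function.Surjective (phi δ a) := by
  rintro ⟨T, hT⟩
  rw [mem_LinPoly, ← Finsupp.range_linearCombination] at hT
  obtain ⟨f, rfl⟩ := hT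
  exact ⟨f, rfl⟩

theorem phi_smul (a : Fin n → F) (k : F) (f : SkewPoly σ δ) :
    phi δ a (k • f) = k • phi δ a f :=
  Subtype.ext (AddMonoidHom.ext (toOp_smul_apply a k f))

/-- For `S ⊆ 𝒞(𝐚)`, the map `f + I(S) ↦ f^{𝒟_𝐚} + I(S^𝒟)`. -/
noncomputable def linQuotientMap (hS : S ⊆ conjClass δ a) :
    (SkewPoly σ δ ⧸ vanishingIdeal δ S) →ₛₗ[phi δ a] LinPoly δ a ⧸ linIdeal δ a (linSpace δ a S) :=
  Submodule.mapQ _ _ (phi δ a).toSemilinearMap (comap_linIdeal_linSpace hS).ge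

theorem linQuotientMap_bijective (hS : S ⊆ conjClass δ a) :
    Function.Bijective (linQuotientMap hS) := by
  refine ⟨(injective_iff_map_eq_zero _).2 fun x hx => ?_, fun y => ?_⟩
  · obtain ⟨f, rfl⟩ := Submodule.Quotient.mk_surjective _ x
    have hf := (Submodule.Quotient.mk_eq_zero (linIdeal δ a (linSpace δ a S))).1 hx
    exact (Submodule.Quotient.mk_eq_zero _).2 ((comap_linIdeal_linSpace hS).le hf)
  · obtain ⟨T, rfl⟩ := Submodule.Quotient.mk_surjective _ y
    obtain ⟨f, rfl⟩ := phi_surjective a T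
    exact ⟨Submodule.Quotient.mk f, rfl⟩

theorem linQuotientMap_mul (hS : S ⊆ conjClass δ a) [(vanishingIdeal δ S).IsTwoSided]
    [(linIdeal δ a (linSpace δ a S)).IsTwoSided] (x y : SkewPoly σ δ ⧸ vanishingIdeal δ S) :
    linQuotientMap hS (x * y) = linQuotientMap hS x * linQuotientMap hS y := by
  obtain ⟨f, rfl⟩ := Submodule.Quotient.mk_surjective _ x
  obtain ⟨g, rfl⟩ := Submodule.Quotient.mk_surjective _ y
  exact congrArg Submodule.Quotient.mk (map_mul (phi δ a) f g)

theorem linQuotientMap_one (hS : S ⊆ conjClass δ a) [(vanishingIdeal δ S).IsTwoSided]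
    [(linIdeal δ a (linSpace δ a S)).IsTwoSided] : linQuotientMap hS 1 = 1 :=
  congrArg Submodule.Quotient.mk (map_one (phi δ a))

theorem linQuotientMap_smul (hS : S ⊆ conjClass δ a) (k : F)
    (x : SkewPoly σ δ ⧸ vanishingIdeal δ S) :
    linQuotientMap hS (k • x) = k • linQuotientMap hS x := by
  obtain ⟨f, rfl⟩ := Submodule.Quotient.mk_surjective _ x
  exact congrArg Submodule.Quotient.mk (phi_smul a k f)

/-- For `S ⊆ 𝒞(𝐚)`, the isomorphism `f + I(S) ↦ f^{𝒟_𝐚} + I(S^𝒟)` of left `F`-vector spaces. -/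
noncomputable def linQuotientEquiv (hS : S ⊆ conjClass δ a) :
    (SkewPoly σ δ ⧸ vanishingIdeal δ S) ≃ₗ[F] LinPoly δ a ⧸ linIdeal δ a (linSpace δ a S) :=
  LinearEquiv.ofBijective
    { toFun := linQuotientMap hS
      map_add' := map_add (linQuotientMap hS)
      map_smul' := linQuotientMap_smul hS }
    (linQuotientMap_bijective hS)

theorem IsPFinGen.rank_linQuotient (hΩ : IsPFinGen δ Ω) (h : Ω ⊆ conjClass δ a) :
    Module.rank F (LinPoly δ a ⧸ linIdeal δ a (linSpace δ a Ω)) = pRank δ Ω :=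
  (linQuotientEquiv h).rank_eq.symm.trans hΩ.rank_quotient

theorem isTwoSided_vanishingIdeal_iff (hΩ : IsPClosed δ Ω) :
    (vanishingIdeal δ Ω).IsTwoSided ↔ ∀ b ∈ Ω, conjClass δ b ⊆ Ω := by
  constructor
  · rintro _ b hb _ ⟨β, hβ, rfl⟩
    rw [← hΩ]
    intro f hf
    have := (vanishingIdeal δ Ω).mul_mem_right (C δ β) hf b hb
    rwa [eval_mul, eval_eq_toOp_one, toOp_C, mul_one, toOp_eq_zero_iff hβ] at this
  · refine fun h => ⟨fun {f} g hf b hb => ?_⟩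
    rw [eval_mul]
    obtain h0 | h0 := eq_or_ne (eval b g) 0
    · rw [h0, map_zero]
    · exact (toOp_eq_zero_iff h0 f).2 (hf _ (h b hb ⟨_, h0, rfl⟩))

theorem IsPFinGen.isTwoSided_vanishingIdeal_iff_forall {ι : Type*} {a : ι → Fin n → F}
    (hΩ : IsPFinGen δ Ω) (hcover : Ω ⊆ ⋃ i, conjClass δ (a i)) :
    (vanishingIdeal δ Ω).IsTwoSided ↔
      ∀ i, (vanishingIdeal δ (Ω ∩ conjClass δ (a i))).IsTwoSided := by
  simp only [isTwoSided_vanishingIdeal_iff hΩ.isPClosed,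
    isTwoSided_vanishingIdeal_iff (hΩ.inter_conjClass _).isPClosed]
  constructor
  · rintro h i b ⟨hb, hba⟩ c hc
    exact ⟨h b hb hc, mem_conjClass_trans hba hc⟩
  · intro h b hb
    obtain ⟨i, hba⟩ := Set.mem_iUnion.1 (hcover hb)
    exact fun c hc => (h i b ⟨hb, hba⟩ hc).1

theorem isTwoSided_comap_iff {R R' : Type*} [Ring R] [Ring R'] {f : R →+* R'}
    (hf : Function.Surjective f) {J : Ideal R'} : (J.comap f).IsTwoSided ↔ J.IsTwoSided := by
  refine ⟨fun _ => ⟨fun {y} z hy => ?_⟩, fun _ => inferInstance⟩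
  obtain ⟨x, rfl⟩ := hf y
  obtain ⟨w, rfl⟩ := hf z
  exact map_mul f x w ▸ (J.comap f).mul_mem_right w hy

theorem isTwoSided_linIdeal_linSpace_iff (hS : S ⊆ conjClass δ a) :
    (linIdeal δ a (linSpace δ a S)).IsTwoSided ↔ (vanishingIdeal δ S).IsTwoSided := by
  rw [← comap_linIdeal_linSpace hS, isTwoSided_comap_iff (phi_surjective a)]

end SkewPolys

theorem mainTheorem6 {F : Type u} [DivisionRing F] {n l : ℕ}
    (σ : F →+* Matrix (Fin n) (Fin n) F) (δ : SkewDerivation σ)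
    (Ω : Set (Fin n → F)) (hΩ : IsPClosed δ Ω) (hfg : IsPFinGen δ Ω)
    (a : Fin l → Fin n → F) (ha : ∀ i j, i ≠ j → a j ∉ conjClass δ (a i))
    (Ω' : Fin l → Set (Fin n → F)) (hΩ' : ∀ i, Ω' i = Ω ∩ conjClass δ (a i))
    (hne : ∀ i, (Ω' i).Nonempty) (hcover : Ω = ⋃ i, Ω' i)
    (V : ∀ i, Submodule (↥(centralizer δ (a i)))ᵐᵒᵖ F)
    (hV : ∀ i, V i = linSpace δ (a i) (Ω' i)) :
    -- the pieces are finitely generated P-closed sets, with the expected right vector spaces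
    (∀ i, IsPClosed δ (Ω' i) ∧ IsPFinGen δ (Ω' i) ∧
      Module.Finite (↥(centralizer δ (a i)))ᵐᵒᵖ (V i) ∧
      Ω' i = {b | ∃ β ∈ V i, β ≠ 0 ∧ b = conj δ (a i) β}) ∧
    -- the two maps are isomorphisms
    (∃ (Φ : (SkewPoly σ δ ⧸ vanishingIdeal δ Ω) ≃ₗ[SkewPoly σ δ]
          (∀ i, SkewPoly σ δ ⧸ vanishingIdeal δ (Ω' i)))
        (Ψ : (∀ i, SkewPoly σ δ ⧸ vanishingIdeal δ (Ω' i)) ≃ₗ[F]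
          (∀ i, LinPoly δ (a i) ⧸ linIdeal δ (a i) (V i))),
      (∀ f : SkewPoly σ δ,
        Φ (Submodule.Quotient.mk f) = fun _ => Submodule.Quotient.mk f) ∧
      (∀ f : Fin l → SkewPoly σ δ,
        Ψ (fun i => Submodule.Quotient.mk (f i)) =
          fun i => Submodule.Quotient.mk (phi δ (a i) (f i))) ∧
      -- they are left linear over `F` and over the skew polynomial ring
      (∀ (c : F) x, Φ (c • x) = c • Φ x) ∧
      (∀ (f : SkewPoly σ δ) x i, Ψ (f • x) i = phi δ (a i) f • Ψ x i) ∧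
      -- once one of the three ideals or families of ideals is two-sided, all are (so that all
      -- quotients are rings), and the maps are multiplicative
      ((vanishingIdeal δ Ω).IsTwoSided ↔ ∀ i, (vanishingIdeal δ (Ω' i)).IsTwoSided) ∧
      ((vanishingIdeal δ Ω).IsTwoSided ↔ ∀ i, (linIdeal δ (a i) (V i)).IsTwoSided) ∧
      (∀ [(vanishingIdeal δ Ω).IsTwoSided] [∀ i, (vanishingIdeal δ (Ω' i)).IsTwoSided]
          [∀ i, (linIdeal δ (a i) (V i)).IsTwoSided],
        (∀ x y, Φ (x * y) = Φ x * Φ y) ∧ Φ 1 = 1 ∧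
        (∀ x y, Ψ (x * y) = Ψ x * Ψ y) ∧ Ψ 1 = 1)) ∧
    -- the ranks are well defined
    ((∃ B, IsPBasis δ B Ω) ∧ ∀ B, IsPBasis δ B Ω → B.Finite ∧ B.ncard = pRank δ Ω) ∧
    (∀ i, (∃ B, IsPBasis δ B (Ω' i)) ∧
      ∀ B, IsPBasis δ B (Ω' i) → B.Finite ∧ B.ncard = pRank δ (Ω' i)) ∧
    -- the dimensions, piece by piece and in total
    (∀ i, Module.rank F (LinPoly δ (a i) ⧸ linIdeal δ (a i) (V i)) =
        Module.rank (↥(centralizer δ (a i)))ᵐᵒᵖ (V i) ∧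
      Module.rank (↥(centralizer δ (a i)))ᵐᵒᵖ (V i) = (pRank δ (Ω' i) : Cardinal.{u})) ∧
    (∑ i, Module.rank F (LinPoly δ (a i) ⧸ linIdeal δ (a i) (V i)) =
      ∑ i, Module.rank (↥(centralizer δ (a i)))ᵐᵒᵖ (V i)) ∧
    (∑ i, Module.rank (↥(centralizer δ (a i)))ᵐᵒᵖ (V i) =
      ((∑ i, pRank δ (Ω' i) : ℕ) : Cardinal.{u})) ∧
    (((∑ i, pRank δ (Ω' i) : ℕ) : Cardinal.{u}) =
      Module.rank F (SkewPoly σ δ ⧸ vanishingIdeal δ Ω)) ∧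
    (Module.rank F (SkewPoly σ δ ⧸ vanishingIdeal δ Ω) = (pRank δ Ω : Cardinal.{u})) := by
  obtain rfl : Ω' = fun i => Ω ∩ conjClass δ (a i) := funext hΩ'
  obtain rfl : V = fun i => linSpace δ (a i) (Ω ∩ conjClass δ (a i)) := funext hV
  have hsub (i : Fin l) : Ω ∩ conjClass δ (a i) ⊆ conjClass δ (a i) := Set.inter_subset_right
  have hpiece (i : Fin l) := hfg.inter_conjClass (a i)
  have hcov : Ω ⊆ ⋃ i, conjClass δ (a i) := hcover.le.trans (Set.iUnion_mono hsub)
  have htwo := hfg.isTwoSided_vanishingIdeal_iff_forall hcov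
  have htwo_lin := htwo.trans
    (forall_congr' fun i => (isTwoSided_linIdeal_linSpace_iff (hsub i)).symm)
  have hrank_lin (i : Fin l) := (hpiece i).rank_linSpace (hsub i)
  have hrank_quot (i : Fin l) := (hpiece i).rank_linQuotient (hsub i)
  refine ⟨fun i => ?_, ?_, ?_, fun i => ?_, fun i => ?_, ?_, ?_, ?_, hfg.rank_quotient⟩
  · exact ⟨(hpiece i).isPClosed, hpiece i, (hpiece i).finite_linSpace (hsub i),
      (hpiece i).isPClosed.eq_conj_linSpace (hsub i)⟩
  · exact ⟨conjClassQuotientEquiv hfg ha hcov, .piCongrRight fun i => linQuotientEquiv (hsub i),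
      fun _ => rfl, fun _ => rfl, LinearMap.map_smul_of_tower _,
      fun f x i => map_smulₛₗ (linQuotientMap (hsub i)) f (x i), htwo, htwo_lin,
      conjClassQuotientEquiv_mul hfg ha hcov, rfl,
      fun x y => funext fun i => linQuotientMap_mul (hsub i) (x i) (y i),
      funext fun i => linQuotientMap_one (hsub i)⟩
  · exact ⟨hfg.exists_isPBasis, fun _ hB => hB.finite_and_ncard_eq_pRank hfg⟩
  · exact ⟨(hpiece i).exists_isPBasis, fun _ hB => hB.finite_and_ncard_eq_pRank (hpiece i)⟩
  · exact ⟨(hrank_quot i).trans (hrank_lin i).symm, hrank_lin i⟩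
  · simp only [hrank_quot, hrank_lin]
  · simp only [hrank_lin, Nat.cast_sum]
  · rw [hfg.rank_quotient, hfg.pRank_eq_sum ha hcov]
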